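/- **Setting.** Let $f_0$ be a Schwarz symmetric, piecewise analytic function and $f(z;x,t)=f_0(z)+2zx+2tz^2$. For $(x,t)$ near $(x_b,t_b)$ let a Schwarz symmetric contour be given that consists of $N+1$ disjoint simple main arcs $\gamma_{m,j}$ ($0\le j\le N$) and finitely many complementary arcs $\gamma_{c,k}$ joining endpoints of main arcs, and let the genus-$N$ $g$-function $g(z;x,t)$ be a bounded Schwarz symmetric function, analytic on the Riemann sphere off the contour, with $g_++g_-=f+W_j$ on $\gamma_{m,j}$ and $g_+-g_-=\Omega_k$ on $\gamma_{c,k}$, where $W_j,\Omega_k$ are real and $W_0=0$, such that $h^N=2g-f$ satisfies $\operatorname{Im}h^N=O(|z-\alpha|^{3/2})$ at every endpoint $\alpha$ of a main arc except fixed ones (hard edges). Put $p=-\tfrac12h^N_x$, $q=-\tfrac12h^N_t$. A point $z_0\in\mathbb R$ at which $h^N$ is analytic and $h^N_z(z_0)=h^N_{zz}(z_0)=0$ is called a real double point, and its velocity is $V=\frac{dq}{dp}=\frac{h^N_{tz}}{h^N_{xz}}$ at $z_0$. **(1)** Suppose that $h^N(z;x,t)$ is analytic in $z$ and $C^3$ in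 $(z,x,t)$ near $(z_0,x_b,t_b)$, with $z_0\in\mathbb R$, that a regular differentiable curve $(x,t)$ through $(x_b,t_b)$ (the breaking curve), together with a differentiable real function $z_0$ along it, satisfies $h^N_z(z_0)=h^N_{zz}(z_0)=0$, and that $dp\ne0$ at $z_0$. Then $dt\neq 0$ along the curve at $(x_b,t_b)$, and the velocity of the double point there is $$V=-\frac{dx}{dt},$$ so it is real. If moreover $dx\ne0$ along the curve and $h^N_{zzt}(z_0)\ne0$ there, then $\frac{dt}{dx}=-\frac{h^N_{zzz}\frac{dz_0}{dx}+h^N_{zzx}}{h^N_{zzt}}$. **(2)** Consider the box potential $q\,\chi_{[-L,L]}$ ($q,L>0$) in genus zero: $f_0(z)=-2Lz$, there is one main arc, the vertical segment from $-iq$ to $iq$, both of whose endpoints are fixed, and there are no complementary arcs. The $g$-function exists for all real $x,t$. For $x<L$ and $t>0$, a real $z_0$ is a double point of $h^0(\cdot\,;x,t)$ if and only if $$\frac{L-x}{t}=2\sqrt2\,q\quad\text{and}\quad z_0=\frac{q}{\sqrt2}.$$ So the breaking curve is $(L-x)/t=2\sqrt2\,q$, along it the double point $z_0=q/\sqrt2$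 is stationary, and there $dp\neq0$ and the velocity is $V=2\sqrt2\,q$. -/

import Mathlib

open Set Filter Topology
open scoped ComplexConjugate

noncomputable section

namespace FocusingNLS

/-- A simple oriented arc in the complex plane, parametrized by `[0,1]`, which is continuously
differentiable with nonzero velocity away from its endpoints and a finite exceptional set. -/
structure Arc where
  toFun : ℝ → ℂ
  exceptional : Finset ℝ
  continuousOn : ContinuousOn toFun (Icc 0 1)
  injOn : InjOn toFun (Icc 0 1)
  smooth : ∀ s ∈ Ioo (0 : ℝ) 1, s ∉ exceptional →
    ContDiffAt ℝ 1 toFun s ∧ deriv toFun s ≠ 0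

namespace Arc

/-- The closed arc as a set. -/
def trace (γ : Arc) : Set ℂ := γ.toFun '' Icc 0 1

/-- The arc without its endpoints. -/
def inner (γ : Arc) : Set ℂ := γ.toFun '' Ioo 0 1

/-- The two endpoints. -/
def endpoints (γ : Arc) : Set ℂ := {γ.toFun 0, γ.toFun 1}

/-- The regular parameters. -/
def regular (γ : Arc) : Set ℝ := {s | s ∈ Ioo (0 : ℝ) 1 ∧ s ∉ γ.exceptional}

/-- `g` has the boundary value `c` at `γ(s)` from the positive (left) side of the arc. The point
`γ(s') + δ i γ'(s')` lies to the left of the arc for small `δ > 0`. -/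
def HasLeftValue (γ : Arc) (g : ℂ → ℂ) (s : ℝ) (c : ℂ) : Prop :=
  Tendsto (fun p : ℝ × ℝ => g (γ.toFun p.1 + (p.2 : ℂ) * (Complex.I * deriv γ.toFun p.1)))
    (𝓝 s ×ˢ 𝓝[>] (0 : ℝ)) (𝓝 c)

/-- `g` has the boundary value `c` at `γ(s)` from the negative (right) side of the arc. -/
def HasRightValue (γ : Arc) (g : ℂ → ℂ) (s : ℝ) (c : ℂ) : Prop :=
  Tendsto (fun p : ℝ × ℝ => g (γ.toFun p.1 + (p.2 : ℂ) * (Complex.I * deriv γ.toFun p.1)))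
    (𝓝 s ×ˢ 𝓝[<] (0 : ℝ)) (𝓝 c)

end Arc

/-- A Schwarz symmetric contour of genus `N`: it has `N + 1` pairwise disjoint main arcs (bands),
whose `2N + 2` endpoints are the branchpoints, and `M` complementary arcs (gaps) that join
endpoints of main arcs. -/
structure Contour (N M : ℕ) where
  main : Fin (N + 1) → Arc
  gap : Fin M → Arc
  main_disjoint : ∀ i j, i ≠ j → Disjoint (main i).trace (main j).trace
  gap_main : ∀ k i, Disjoint (gap k).inner (main i).trace
  main_gap : ∀ i k, Disjoint (main i).inner (gap k).trace
  gap_disjoint : ∀ k l, k ≠ l → Disjoint (gap k).inner (gap l).trace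
  gap_endpoints : ∀ k, ∀ e ∈ (gap k).endpoints, ∃ i, e ∈ (main i).endpoints
  symm : ∀ z ∈ (⋃ i, (main i).trace) ∪ ⋃ k, (gap k).trace,
    conj z ∈ (⋃ i, (main i).trace) ∪ ⋃ k, (gap k).trace

/-- The union of all arcs of the contour. -/
def Contour.support {N M : ℕ} (C : Contour N M) : Set ℂ :=
  (⋃ i, (C.main i).trace) ∪ ⋃ k, (C.gap k).trace

/-- The input `f(z; x, t) = f₀(z) + 2 z x + 2 t z²` of the scalar Riemann-Hilbert problem. -/
def inputF (f₀ : ℂ → ℂ) (z : ℂ) (x t : ℝ) : ℂ := f₀ z + 2 * z * x + 2 * t * z ^ 2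

/-- `h = 2 g - f`. -/
def phaseH (f₀ : ℂ → ℂ) (g : ℝ → ℝ → ℂ → ℂ) (z : ℂ) (x t : ℝ) : ℂ :=
  2 * g x t z - inputF f₀ z x t

/-- `g` is the (Schwarz symmetric) `g`-function at the point `(x, t)` for the contour `C`: it
solves the scalar Riemann-Hilbert problem
`g₊ + g₋ = f + Wᵢ` on main arcs, `g₊ - g₋ = Ωₖ` on complementary arcs, with `g` analytic in the
rest of the Riemann sphere and with bounded boundary values, and the modulation equations
`Im h = O((z - α)^{3/2})` hold at every branchpoint `α` other than the fixed ones (hard edges). -/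
structure IsGFunction {N M : ℕ} (f₀ : ℂ → ℂ) (hard : Finset ℂ) (C : Contour N M)
    (W : Fin (N + 1) → ℝ) (Ω : Fin M → ℝ) (x t : ℝ) (g : ℂ → ℂ) : Prop where
  analytic_input : ∀ i, ∀ s ∈ (C.main i).regular, AnalyticAt ℂ f₀ ((C.main i).toFun s)
  symm_input : ∀ z : ℂ, z.im ≠ 0 → f₀ (conj z) = conj (f₀ z)
  analytic : DifferentiableOn ℂ g C.supportᶜ
  analytic_infinity : ∃ c, Tendsto g (Bornology.cobounded ℂ) (𝓝 c)
  bounded : ∃ B : ℝ, ∀ z ∈ C.supportᶜ, ‖g z‖ ≤ B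
  symm : ∀ z ∈ C.supportᶜ, g (conj z) = conj (g z)
  normalized : W 0 = 0
  jump_main : ∀ i, ∀ s ∈ (C.main i).regular, ∃ a b : ℂ,
    (C.main i).HasLeftValue g s a ∧ (C.main i).HasRightValue g s b ∧
      a + b = inputF f₀ ((C.main i).toFun s) x t + W i
  jump_gap : ∀ k, ∀ s ∈ (C.gap k).regular, ∃ a b : ℂ,
    (C.gap k).HasLeftValue g s a ∧ (C.gap k).HasRightValue g s b ∧ a - b = Ω k
  modulation : ∀ i, ∀ e ∈ (C.main i).endpoints, e ∉ hard →
    (fun z => (2 * g z - inputF f₀ z x t).im) =O[𝓝[C.supportᶜ] e]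
      fun z => ‖z - e‖ ^ (3 / 2 : ℝ)

/-- The real point `z₀` is a double point: `h` is analytic there and `h_z = h_zz = 0`. -/
def IsRealDoublePoint (h : ℂ → ℂ) (z₀ : ℝ) : Prop :=
  AnalyticAt ℂ h (z₀ : ℂ) ∧ deriv h (z₀ : ℂ) = 0 ∧ iteratedDeriv 2 h (z₀ : ℂ) = 0

section Potential

variable (h : ℂ → ℝ → ℝ → ℂ) (z : ℂ) (x t : ℝ)

/-- `p = -h_x / 2`. -/
def potP : ℂ := -(1 / 2) * deriv (fun x' => h z x' t) x

/-- `q = -h_t / 2`. -/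
def potQ : ℂ := -(1 / 2) * deriv (fun t' => h z x t') t

/-- The coefficient `dp/dz` of the differential `dp`. -/
def dpCoeff : ℂ := deriv (fun w => potP h w x t) z

/-- The coefficient `dq/dz` of the differential `dq`. -/
def dqCoeff : ℂ := deriv (fun w => potQ h w x t) z

/-- The velocity `V = dq/dp` of a double point. -/
def velocity : ℂ := dqCoeff h z x t / dpCoeff h z x t

/-- `h_zzz`. -/
def hZZZ : ℂ := iteratedDeriv 3 (fun w => h w x t) z

/-- `h_zzx`. -/
def hZZX : ℂ := deriv (fun x' => iteratedDeriv 2 (fun w => h w x' t) z) x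

/-- `h_zzt`. -/
def hZZT : ℂ := deriv (fun t' => iteratedDeriv 2 (fun w => h w x t') z) t

end Potential

/-- The upwards oriented vertical band from `-iq` to `iq`. -/
def boxArc (q : ℝ) (hq : 0 < q) : Arc where
  toFun s := ((q * (2 * s - 1) : ℝ) : ℂ) * Complex.I
  exceptional := ∅
  continuousOn := by fun_prop
  injOn := by
    intro a _ b _ hab
    have h1 : q * (2 * a - 1) = q * (2 * b - 1) := by
      have := congrArg Complex.im hab
      simpa using this
    have h2 := mul_left_cancel₀ hq.ne' h1
    linarith
  smooth := by
    intro s _ _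
    have hd : HasDerivAt (fun s : ℝ => ((q * (2 * s - 1) : ℝ) : ℂ) * Complex.I)
        (((q * (2 * 1) : ℝ) : ℂ) * Complex.I) s :=
      ((((hasDerivAt_id s).const_mul 2).sub_const 1).const_mul q).ofReal_comp.mul_const Complex.I
    refine ⟨?_, ?_⟩
    · have : ContDiff ℝ 1 (fun s : ℝ => (q * (2 * s - 1) : ℝ)) := by fun_prop
      exact ((Complex.ofRealCLM.contDiff.comp this).mul contDiff_const).contDiffAt
    · rw [hd.deriv]
      simp [hq.ne']

/-- The genus zero contour of the box potential: one vertical band from `-iq` to `iq`. -/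
def boxContour (q : ℝ) (hq : 0 < q) : Contour 0 0 where
  main _ := boxArc q hq
  gap := Fin.elim0
  main_disjoint i j hij := absurd (Fin.ext (by omega)) hij
  gap_main k := k.elim0
  main_gap _ k := k.elim0
  gap_disjoint k := k.elim0
  gap_endpoints k := k.elim0
  symm := by
    rintro z (hz | hz)
    · left
      obtain ⟨i, s, ⟨h0, h1⟩, rfl⟩ := mem_iUnion.1 hz
      refine mem_iUnion.2 ⟨i, 1 - s, ⟨by linarith, by linarith⟩, ?_⟩
      simp only [boxArc, map_mul, Complex.conj_ofReal, Complex.conj_I]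
      push_cast
      ring
    · obtain ⟨k, _⟩ := mem_iUnion.1 hz
      exact k.elim0

/-- For the box potential `q χ_[-L,L]`, `f₀(z) = -2 L z` on the genus zero band. -/
def boxF₀ (L : ℝ) (z : ℂ) : ℂ := -2 * L * z

/-- `g x t` is the genus zero `g`-function of the box potential at `(x, t)`; both branchpoints
`± iq` are fixed. -/
def IsBoxGFunction (q L : ℝ) (hq : 0 < q) (x t : ℝ) (g : ℂ → ℂ) : Prop :=
  IsGFunction (boxF₀ L) {q * Complex.I, -(q * Complex.I)} (boxContour q hq) 0 0 x t g

end FocusingNLS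

end

/-!
At a double point `h_zz = 0`, so differentiating `h_z = 0` along the breaking curve leaves
`h_zx dx + h_zt dt = 0`, that is, `dp dx + dq dt = 0`. Differentiating `h_zz = 0` gives the slope
formula. Since `h` is holomorphic in `z` but only finitely smooth in `(x, t)`, mixed derivatives
are exchanged by symmetry of the real second derivative.

For the box potential let `R` be the branch of `√(z² + q²)` that is cut along the band. The
`g`-function is `(t z - (L - x)) (z - R)`: the difference of two solutions changes sign across the
band, so its product with `R` extends to an entire function of at most linear growth which vanishes
at `± i q`, hence is zero. Thus `h = -2 (t z - (L - x)) R` and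
`h_z = -2 (2 t z² - (L - x) z + t q²) / R`, whose double zeros are those of the quadratic. The
origin is on the band, where `h` jumps, so it is never a double point.
-/

noncomputable section

namespace FocusingNLS

section PartialDerivatives

variable {E F : Type*} [NormedAddCommGroup F] [NormedSpace ℂ F]

/-- The complex partial derivative of `K` in its first variable, as a function of all variables. -/
def derivFst (K : ℂ × E → F) (p : ℂ × E) : F := deriv (fun w => K (w, p.2)) p.1

variable {K : ℂ × E → F}

theorem eventually_analyticAt_derivFst [TopologicalSpace E] [CompleteSpace F] {p : ℂ × E}
    (hA : ∀ᶠ p' in 𝓝 p, AnalyticAt ℂ (fun w => K (w, p'.2)) p'.1) :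
    ∀ᶠ p' in 𝓝 p, AnalyticAt ℂ (fun w => derivFst K (w, p'.2)) p'.1 :=
  hA.mono fun _ h => h.deriv

variable [NormedAddCommGroup E] [NormedSpace ℝ E] {p : ℂ × E}

theorem fderiv_apply_fst (hK : DifferentiableAt ℝ K p)
    (hA : DifferentiableAt ℂ (fun w => K (w, p.2)) p.1) (v : ℂ) :
    fderiv ℝ K p (v, 0) = v • derivFst K p := by
  have along_slice : HasFDerivAt (fun w => K (w, p.2))
      ((fderiv ℝ K p).comp (ContinuousLinearMap.inl ℝ ℂ E)) p.1 :=
    HasFDerivAt.comp p.1 (g := K) hK.hasFDerivAt (hasFDerivAt_prodMk_left p.1 p.2)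
  have := along_slice.unique (hA.hasDerivAt.hasFDerivAt.restrictScalars ℝ)
  simpa [derivFst] using DFunLike.congr_fun this v

theorem eventually_fderiv_apply_fst (hK : ContDiffAt ℝ 1 K p)
    (hA : ∀ᶠ p' in 𝓝 p, AnalyticAt ℂ (fun w => K (w, p'.2)) p'.1) :
    ∀ᶠ p' in 𝓝 p, ∀ v, fderiv ℝ K p' (v, 0) = v • derivFst K p' := by
  filter_upwards [hK.eventually (by simp), hA] with p' hK' hA' v
  exact fderiv_apply_fst (hK'.differentiableAt (by simp)) hA'.differentiableAt v

theorem contDiffAt_derivFst {n : ℕ} (hK : ContDiffAt ℝ (n + 1 : ℕ) K p)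
    (hA : ∀ᶠ p' in 𝓝 p, AnalyticAt ℂ (fun w => K (w, p'.2)) p'.1) :
    ContDiffAt ℝ n (derivFst K) p := by
  have : ContDiffAt ℝ n (fun p' => fderiv ℝ K p' (1, 0)) p :=
    (hK.fderiv_right (by simp)).clm_apply contDiffAt_const
  refine this.congr_of_eventuallyEq ?_
  filter_upwards [eventually_fderiv_apply_fst (hK.of_le (by simp)) hA] with p' hp'
  rw [hp', one_smul]

theorem fderiv_fderiv_apply_fst (hK : ContDiffAt ℝ 2 K p)
    (hA : ∀ᶠ p' in 𝓝 p, AnalyticAt ℂ (fun w => K (w, p'.2)) p'.1) (v : ℂ) (u : E) :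
    fderiv ℝ (fderiv ℝ K) p (v, 0) (0, u) = v • fderiv ℝ (derivFst K) p (0, u) := by
  have hsymm : IsSymmSndFDerivAt ℝ K p := hK.isSymmSndFDerivAt (by simp)
  have hf : DifferentiableAt ℝ (fderiv ℝ K) p :=
    (hK.fderiv_right (m := 1) (by norm_num)).differentiableAt (by simp)
  have hF : DifferentiableAt ℝ (derivFst K) p :=
    (contDiffAt_derivFst (n := 1) (by exact_mod_cast hK) hA).differentiableAt (by simp)
  have hv : HasFDerivAt (fun p' => fderiv ℝ K p' (v, 0))
      ((fderiv ℝ (fderiv ℝ K) p).flip (v, 0)) p := by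
    simpa using hf.hasFDerivAt.clm_apply (hasFDerivAt_const (v, (0 : E)) p)
  have hv' : HasFDerivAt (fun p' => fderiv ℝ K p' (v, 0)) (v • fderiv ℝ (derivFst K) p) p :=
    (hF.hasFDerivAt.const_smul v).congr_of_eventuallyEq <|
      (eventually_fderiv_apply_fst (hK.of_le (by norm_num)) hA).mono fun _ h => h v
  rw [hsymm]
  simpa using DFunLike.congr_fun (hv.unique hv') (0, u)

variable {ζ : ℝ → ℂ} {ζ' : ℂ} {c : ℝ → E} {c' : E} {z : ℂ} {s : ℝ}

theorem hasDerivAt_comp_prodMk_right (hK : DifferentiableAt ℝ K (z, c s)) (hc : HasDerivAt c c' s) :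
    HasDerivAt (fun r => K (z, c r)) (fderiv ℝ K (z, c s) (0, c')) s :=
  HasFDerivAt.comp_hasDerivAt s (l := K) hK.hasFDerivAt ((hasDerivAt_const s z).prodMk hc)

theorem hasDerivAt_comp_prodMk (hK : DifferentiableAt ℝ K (ζ s, c s))
    (hA : DifferentiableAt ℂ (fun w => K (w, c s)) (ζ s)) (hζ : HasDerivAt ζ ζ' s)
    (hc : HasDerivAt c c' s) :
    HasDerivAt (fun r => K (ζ r, c r))
      (ζ' • derivFst K (ζ s, c s) + fderiv ℝ K (ζ s, c s) (0, c')) s := by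
  rw [← fderiv_apply_fst hK hA, ← map_add, Prod.mk_add_mk, add_zero, zero_add]
  exact HasFDerivAt.comp_hasDerivAt s (l := K) hK.hasFDerivAt (hζ.prodMk hc)

theorem hasDerivAt_deriv_comp_prodMk_right (hK : ContDiffAt ℝ 2 K (z, c s))
    (hA : ∀ᶠ p in 𝓝 (z, c s), AnalyticAt ℂ (fun w => K (w, p.2)) p.1) (hc : HasDerivAt c c' s) :
    HasDerivAt (fun w => deriv (fun r => K (w, c r)) s)
      (fderiv ℝ (derivFst K) (z, c s) (0, c')) z := by
  have hf : DifferentiableAt ℝ (fderiv ℝ K) (z, c s) :=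
    (hK.fderiv_right (m := 1) (by norm_num)).differentiableAt (by simp)
  have hslice : HasFDerivAt (fun w => fderiv ℝ K (w, c s) (0, c'))
      (((fderiv ℝ (fderiv ℝ K) (z, c s)).flip (0, c')).comp (ContinuousLinearMap.inl ℝ ℂ E)) z := by
    have : HasFDerivAt (fun p => fderiv ℝ K p (0, c'))
        ((fderiv ℝ (fderiv ℝ K) (z, c s)).flip (0, c')) (z, c s) := by
      simpa using hf.hasFDerivAt.clm_apply (hasFDerivAt_const ((0 : ℂ), c') (z, c s))
    exact HasFDerivAt.comp z (g := fun p => fderiv ℝ K p (0, c')) this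
      (hasFDerivAt_prodMk_left z (c s))
  have hcomplex : HasDerivAt (fun w => fderiv ℝ K (w, c s) (0, c'))
      (fderiv ℝ (derivFst K) (z, c s) (0, c')) z := by
    refine hasFDerivAt_of_restrictScalars ℝ hslice (ContinuousLinearMap.ext fun v => ?_)
    simpa using (fderiv_fderiv_apply_fst hK hA v c').symm
  refine hcomplex.congr_of_eventuallyEq ?_
  have hnear : ∀ᶠ p in 𝓝 (z, c s), DifferentiableAt ℝ K p :=
    (hK.eventually (by simp)).mono fun _ h => h.differentiableAt (by simp)
  filter_upwards [(Continuous.prodMk_left (c s)).tendsto z |>.eventually hnear] with w hw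
  exact (hasDerivAt_comp_prodMk_right hw hc).deriv

end PartialDerivatives

section BreakingCurve

variable {h : ℂ → ℝ → ℝ → ℂ} {z : ℂ} {x t : ℝ}

theorem dpCoeff_eq_fderiv (hK : ContDiffAt ℝ 2 ↿h (z, x, t))
    (hA : ∀ᶠ p : ℂ × ℝ × ℝ in 𝓝 (z, x, t), AnalyticAt ℂ (fun w => h w p.2.1 p.2.2) p.1) :
    dpCoeff h z x t = -(1 / 2) * fderiv ℝ (derivFst ↿h) (z, x, t) (0, 1, 0) :=
  ((hasDerivAt_deriv_comp_prodMk_right (K := ↿h) (c := fun r => (r, t)) hK hA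
    ((hasDerivAt_id x).prodMk (hasDerivAt_const x t))).const_mul _).deriv

theorem dqCoeff_eq_fderiv (hK : ContDiffAt ℝ 2 ↿h (z, x, t))
    (hA : ∀ᶠ p : ℂ × ℝ × ℝ in 𝓝 (z, x, t), AnalyticAt ℂ (fun w => h w p.2.1 p.2.2) p.1) :
    dqCoeff h z x t = -(1 / 2) * fderiv ℝ (derivFst ↿h) (z, x, t) (0, 0, 1) :=
  ((hasDerivAt_deriv_comp_prodMk_right (K := ↿h) (c := fun r => (x, r)) hK hA
    ((hasDerivAt_const t x).prodMk (hasDerivAt_id t))).const_mul _).deriv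

theorem iteratedDeriv_two_eq_derivFst (h : ℂ → ℝ → ℝ → ℂ) (z : ℂ) (x t : ℝ) :
    iteratedDeriv 2 (fun w => h w x t) z = derivFst (derivFst ↿h) (z, x, t) := by
  rw [iteratedDeriv_succ, iteratedDeriv_one]
  rfl

theorem hZZZ_eq_derivFst (h : ℂ → ℝ → ℝ → ℂ) (z : ℂ) (x t : ℝ) :
    hZZZ h z x t = derivFst (derivFst (derivFst ↿h)) (z, x, t) := by
  rw [hZZZ, iteratedDeriv_succ, funext fun w => iteratedDeriv_two_eq_derivFst h w x t]
  rfl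

theorem hZZX_eq_fderiv (hK : DifferentiableAt ℝ (derivFst (derivFst ↿h)) (z, x, t)) :
    hZZX h z x t = fderiv ℝ (derivFst (derivFst ↿h)) (z, x, t) (0, 1, 0) := by
  simp only [hZZX, iteratedDeriv_two_eq_derivFst]
  exact (hasDerivAt_comp_prodMk_right (c := fun r => (r, t)) hK
    ((hasDerivAt_id x).prodMk (hasDerivAt_const x t))).deriv

theorem hZZT_eq_fderiv (hK : DifferentiableAt ℝ (derivFst (derivFst ↿h)) (z, x, t)) :
    hZZT h z x t = fderiv ℝ (derivFst (derivFst ↿h)) (z, x, t) (0, 0, 1) := by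
  simp only [hZZT, iteratedDeriv_two_eq_derivFst]
  exact (hasDerivAt_comp_prodMk_right (c := fun r => (x, r)) hK
    ((hasDerivAt_const t x).prodMk (hasDerivAt_id t))).deriv

variable {X T : ℝ → ℝ} {Z : ℝ → ℂ} {X' T' : ℝ} {Z' : ℂ} {s₀ : ℝ}

theorem derivative_along_curve_eq_zero {K : ℂ × ℝ × ℝ → ℂ}
    (hK : DifferentiableAt ℝ K (Z s₀, X s₀, T s₀))
    (hA : DifferentiableAt ℂ (fun w => K (w, X s₀, T s₀)) (Z s₀))
    (hX : HasDerivAt X X' s₀) (hT : HasDerivAt T T' s₀) (hZ : HasDerivAt Z Z' s₀)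
    (h0 : ∀ᶠ s in 𝓝 s₀, K (Z s, X s, T s) = 0) :
    Z' * derivFst K (Z s₀, X s₀, T s₀)
      + X' * fderiv ℝ K (Z s₀, X s₀, T s₀) (0, 1, 0)
      + T' * fderiv ℝ K (Z s₀, X s₀, T s₀) (0, 0, 1) = 0 := by
  have hzero := (hasDerivAt_comp_prodMk hK hA hZ (hX.prodMk hT)).unique
    ((hasDerivAt_const s₀ (0 : ℂ)).congr_of_eventuallyEq h0)
  have hsplit : ((0 : ℂ), X', T') = X' • ((0 : ℂ), (1 : ℝ), (0 : ℝ)) + T' • (0, 0, 1) := by simp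
  rw [hsplit, map_add, map_smul, map_smul] at hzero
  simpa [add_assoc] using hzero

theorem deriv_mul_dpCoeff_add_deriv_mul_dqCoeff_eq_zero
    (hK : ContDiffAt ℝ 2 ↿h (Z s₀, X s₀, T s₀))
    (hA : ∀ᶠ p : ℂ × ℝ × ℝ in 𝓝 (Z s₀, X s₀, T s₀), AnalyticAt ℂ (fun w => h w p.2.1 p.2.2) p.1)
    (hX : HasDerivAt X X' s₀) (hT : HasDerivAt T T' s₀) (hZ : HasDerivAt Z Z' s₀)
    (hz : ∀ᶠ s in 𝓝 s₀, deriv (fun w => h w (X s) (T s)) (Z s) = 0)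
    (hzz : iteratedDeriv 2 (fun w => h w (X s₀) (T s₀)) (Z s₀) = 0) :
    X' * dpCoeff h (Z s₀) (X s₀) (T s₀) + T' * dqCoeff h (Z s₀) (X s₀) (T s₀) = 0 := by
  have hd : DifferentiableAt ℝ (derivFst ↿h) (Z s₀, X s₀, T s₀) :=
    (contDiffAt_derivFst (n := 1) (by exact_mod_cast hK) hA).differentiableAt (by simp)
  have hzero := derivative_along_curve_eq_zero hd
    (eventually_analyticAt_derivFst (K := ↿h) hA).self_of_nhds.differentiableAt hX hT hZ hz
  rw [← iteratedDeriv_two_eq_derivFst, hzz] at hzero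
  rw [dpCoeff_eq_fderiv hK hA, dqCoeff_eq_fderiv hK hA]
  linear_combination -(1 / 2) * hzero

theorem deriv_mul_hZZZ_add_deriv_mul_hZZX_add_deriv_mul_hZZT_eq_zero
    (hK : ContDiffAt ℝ 3 ↿h (Z s₀, X s₀, T s₀))
    (hA : ∀ᶠ p : ℂ × ℝ × ℝ in 𝓝 (Z s₀, X s₀, T s₀), AnalyticAt ℂ (fun w => h w p.2.1 p.2.2) p.1)
    (hX : HasDerivAt X X' s₀) (hT : HasDerivAt T T' s₀) (hZ : HasDerivAt Z Z' s₀)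
    (hzz : ∀ᶠ s in 𝓝 s₀, iteratedDeriv 2 (fun w => h w (X s) (T s)) (Z s) = 0) :
    Z' * hZZZ h (Z s₀) (X s₀) (T s₀) + X' * hZZX h (Z s₀) (X s₀) (T s₀)
      + T' * hZZT h (Z s₀) (X s₀) (T s₀) = 0 := by
  have hA₁ := eventually_analyticAt_derivFst (K := ↿h) hA
  have hA₂ := eventually_analyticAt_derivFst hA₁
  have hd : DifferentiableAt ℝ (derivFst (derivFst ↿h)) (Z s₀, X s₀, T s₀) := by
    refine (contDiffAt_derivFst (n := 1) ?_ hA₁).differentiableAt (by simp)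
    exact contDiffAt_derivFst (n := 2) (by exact_mod_cast hK) hA
  rw [hZZZ_eq_derivFst, hZZX_eq_fderiv hd, hZZT_eq_fderiv hd]
  simp only [iteratedDeriv_two_eq_derivFst] at hzz
  exact derivative_along_curve_eq_zero hd hA₂.self_of_nhds.differentiableAt hX hT hZ hzz

theorem curve_deriv_snd_ne_zero (hdp : dpCoeff h z x t ≠ 0) (hregular : X' ≠ 0 ∨ T' ≠ 0)
    (hcurve : X' * dpCoeff h z x t + T' * dqCoeff h z x t = 0) : T' ≠ 0 := by
  rintro rfl
  simp_all

theorem velocity_eq_neg_div (hdp : dpCoeff h z x t ≠ 0) (hT' : T' ≠ 0)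
    (hcurve : X' * dpCoeff h z x t + T' * dqCoeff h z x t = 0) :
    velocity h z x t = ((-(X' / T') : ℝ) : ℂ) := by
  have : (T' : ℂ) ≠ 0 := Complex.ofReal_ne_zero.2 hT'
  rw [velocity]
  push_cast
  field_simp
  linear_combination hcurve

theorem curve_slope_eq (hX' : X' ≠ 0) (hzzt : hZZT h z x t ≠ 0)
    (hcurve : Z' * hZZZ h z x t + X' * hZZX h z x t + T' * hZZT h z x t = 0) :
    ((T' / X' : ℝ) : ℂ) = -(hZZZ h z x t * (Z' / X') + hZZX h z x t) / hZZT h z x t := by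
  have : (X' : ℂ) ≠ 0 := Complex.ofReal_ne_zero.2 hX'
  push_cast
  field_simp
  linear_combination hcurve

end BreakingCurve

section EntireFunctions

open MeasureTheory Asymptotics Bornology

variable {E : Type*} [NormedAddCommGroup E] [NormedSpace ℂ E] {c : ℝ}

theorem dense_compl_of_forall_re_eq {S : Set ℂ} (hS : ∀ z ∈ S, z.re = c) : Dense Sᶜ := by
  have hsub : Complex.re ⁻¹' {c}ᶜ ⊆ Sᶜ := fun z hz hzS => hz (hS z hzS)
  exact ((dense_compl_singleton c).preimage Complex.isOpenMap_re).mono hsub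

theorem integral_boundary_rect_eq_zero_of_re_ne {f : ℂ → E} (hf : Continuous f)
    (hd : ∀ z : ℂ, z.re ≠ c → DifferentiableAt ℂ f z) {z w : ℂ}
    (hzw : 0 ≤ (z.re - c) * (w.re - c)) :
    (∫ x : ℝ in z.re..w.re, f (x + z.im * Complex.I))
      - (∫ x : ℝ in z.re..w.re, f (x + w.im * Complex.I))
      + Complex.I • (∫ y : ℝ in z.im..w.im, f (w.re + y * Complex.I))
      - Complex.I • (∫ y : ℝ in z.im..w.im, f (z.re + y * Complex.I)) = 0 := by
  refine Complex.integral_boundary_rect_eq_zero_of_continuousOn_of_differentiableOn f z w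
    hf.continuousOn fun u hu => (hd u ?_).differentiableWithinAt
  obtain ⟨⟨hmin, hmax⟩, -⟩ := hu
  rintro rfl
  rcases min_lt_iff.1 hmin with h₁ | h₁ <;> rcases lt_max_iff.1 hmax with h₂ | h₂ <;> nlinarith

variable [CompleteSpace E]

theorem differentiable_of_differentiableAt_re_ne {f : ℂ → E} (hf : Continuous f)
    (hd : ∀ z : ℂ, z.re ≠ c → DifferentiableAt ℂ f z) : Differentiable ℂ f := by
  rw [← differentiableOn_univ,
    ← Complex.isConservativeOn_and_continuousOn_iff_isDifferentiableOn isOpen_univ]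
  refine ⟨fun z w _ => ?_, hf.continuousOn⟩
  have hint (a b y : ℝ) : IntervalIntegrable (fun x : ℝ => f (x + y * Complex.I)) volume a b :=
    Continuous.intervalIntegrable (by fun_prop) a b
  -- The line `re = c` cuts the rectangle into two rectangles that it only touches.
  have hleft := integral_boundary_rect_eq_zero_of_re_ne hf hd (z := z) (w := ⟨c, w.im⟩) (by simp)
  have hright := integral_boundary_rect_eq_zero_of_re_ne hf hd (z := ⟨c, z.im⟩) (w := w) (by simp)
  rw [← add_eq_zero_iff_eq_neg, Complex.wedgeIntegral_add_wedgeIntegral_eq,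
    ← intervalIntegral.integral_add_adjacent_intervals (hint z.re c z.im) (hint c w.re z.im),
    ← intervalIntegral.integral_add_adjacent_intervals (hint z.re c w.im) (hint c w.re w.im)]
  linear_combination (norm := module) hleft + hright

theorem differentiable_extendFrom_compl {S : Set ℂ} (hclosed : IsClosed S)
    (hS : ∀ z ∈ S, z.re = c) {f : ℂ → E} (hd : DifferentiableOn ℂ f Sᶜ)
    (hlim : ∀ w ∈ S, ∃ a, Tendsto f (𝓝[Sᶜ] w) (𝓝 a)) : Differentiable ℂ (extendFrom Sᶜ f) := by
  have hdiff {z : ℂ} (hz : z ∈ Sᶜ) : DifferentiableAt ℂ f z :=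
    hd.differentiableAt (hclosed.isOpen_compl.mem_nhds hz)
  have hagree : EqOn (extendFrom Sᶜ f) f Sᶜ := fun z hz =>
    extendFrom_eq (subset_closure hz) (hdiff hz).continuousAt.continuousWithinAt
  have hcont : Continuous (extendFrom Sᶜ f) := by
    refine continuous_extendFrom (dense_compl_of_forall_re_eq hS) fun z => ?_
    by_cases hz : z ∈ S
    · exact hlim z hz
    · exact ⟨f z, (hdiff hz).continuousAt.continuousWithinAt⟩
  refine differentiable_of_differentiableAt_re_ne (c := c) hcont fun z hz => ?_
  have hzS : z ∈ Sᶜ := fun h => hz (hS z h)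
  exact (hdiff hzS).congr_of_eventuallyEq (hagree.eventuallyEq_of_mem
    (hclosed.isOpen_compl.mem_nhds hzS))

theorem eq_zero_of_isLittleO_sq {f : ℂ → E} (hf : Differentiable ℂ f) {a b : ℂ} (hab : a ≠ b)
    (ha : f a = 0) (hb : f b = 0) (hgrowth : f =o[cobounded ℂ] fun z => z ^ 2) : f = 0 := by
  have hfactor (z : ℂ) : f z = ((z - a) * (z - b)) • dslope (dslope f a) b z := by
    have hab' : dslope f a b = 0 := by simp [dslope_of_ne _ hab.symm, slope_def_module, ha, hb]
    have h₁ := sub_smul_dslope f a z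
    have h₂ := sub_smul_dslope (dslope f a) b z
    rw [ha, sub_zero] at h₁
    rw [hab', sub_zero] at h₂
    rw [mul_smul, h₂, h₁]
  have hquot : Differentiable ℂ (dslope (dslope f a) b) := by
    rw [← differentiableOn_univ] at hf ⊢
    rwa [Complex.differentiableOn_dslope univ_mem, Complex.differentiableOn_dslope univ_mem]
  have hlim : Tendsto (dslope (dslope f a) b) (cobounded ℂ) (𝓝 0) := by
    have hsub (a : ℂ) : (fun z : ℂ => z) =O[cobounded ℂ] fun z => z - a :=
      (isLittleO_const_id_cobounded a).right_isBigO_sub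
    have hsq : (fun z : ℂ => z ^ 2) =O[cobounded ℂ] fun z => (z - a) * (z - b) := by
      simpa only [pow_two] using (hsub a).mul (hsub b)
    have := (isBigO_refl (fun z => ((z - a) * (z - b))⁻¹) _).smul_isLittleO
      (hgrowth.trans_isBigO hsq)
    refine (isLittleO_one_iff ℂ).1 (this.congr' ?_ ?_)
    all_goals
      filter_upwards [eventually_ne_cobounded a, eventually_ne_cobounded b] with z hza hzb
      have hz : (z - a) * (z - b) ≠ 0 := mul_ne_zero (sub_ne_zero.2 hza) (sub_ne_zero.2 hzb)
    · rw [hfactor z, inv_smul_smul₀ hz]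
    · rw [smul_eq_mul, inv_mul_cancel₀ hz]
  rw [Metric.cobounded_eq_cocompact] at hlim
  funext z
  rw [hfactor, hquot.apply_eq_of_tendsto_cocompact z hlim, smul_zero, Pi.zero_apply]

end EntireFunctions

section BandRoot

open Bornology

theorem sqrt_sq (w : ℂ) : Complex.sqrt w ^ 2 = w := Complex.cpow_ofNat_inv_pow w 2

theorem re_sqrt_pos {w : ℂ} (hw : w ∈ Complex.slitPlane) : 0 < (Complex.sqrt w).re := by
  rw [Complex.sqrt, Complex.cpow_inv_two_re, Real.sqrt_pos]
  rcases Complex.mem_slitPlane_iff.1 hw with hre | him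
  · positivity
  · linarith [Complex.abs_re_lt_norm.2 him, neg_abs_le w.re]

theorem sqrt_conj {w : ℂ} (hw : w ∈ Complex.slitPlane) :
    Complex.sqrt (conj w) = conj (Complex.sqrt w) := by
  rw [Complex.sqrt, Complex.sqrt, Complex.conj_cpow _ _ (Complex.slitPlane_arg_ne_pi hw),
    map_inv₀, Complex.conj_ofNat]

variable {q : ℝ} {z w : ℂ}

theorem sq_add_sq_mem_slitPlane (hz : z.re ≠ 0 ∨ |z.im| < |q|) :
    z ^ 2 + (q : ℂ) ^ 2 ∈ Complex.slitPlane := by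
  have hre : (z ^ 2 + (q : ℂ) ^ 2).re = z.re ^ 2 - z.im ^ 2 + q ^ 2 := by simp [pow_two]
  have him : (z ^ 2 + (q : ℂ) ^ 2).im = 2 * (z.re * z.im) := by simp [pow_two]; ring
  rw [Complex.mem_slitPlane_iff, hre, him]
  by_cases hzre : z.re = 0
  · have := sq_lt_sq.2 (hz.resolve_left (not_not.2 hzre))
    left
    nlinarith
  · by_cases hzim : z.im = 0
    · left
      have := sq_pos_of_ne_zero hzre
      nlinarith [sq_nonneg q]
    · exact Or.inr (by positivity)

theorem continuousAt_sqrt_sq_add_sq (hz : z.re ≠ 0 ∨ |z.im| < |q|) :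
    ContinuousAt (fun z : ℂ => Complex.sqrt (z ^ 2 + q ^ 2)) z :=
  (Complex.differentiableAt_sqrt (sq_add_sq_mem_slitPlane hz)).continuousAt.comp
    (f := fun z : ℂ => z ^ 2 + (q : ℂ) ^ 2) (by fun_prop)

/-- The closed vertical segment between `-iq` and `iq`. -/
def band (q : ℝ) : Set ℂ := {z | z.re = 0 ∧ |z.im| ≤ |q|}

/-- The branch of `√(z² + q²)` with branch cut `band q` that is asymptotic to `z` at infinity.
Its values on the band itself carry no meaning. -/
def bandRoot (q : ℝ) (z : ℂ) : ℂ := z * Complex.sqrt (1 + (q / z) ^ 2)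

theorem notMem_band_of_re_ne_zero (hz : z.re ≠ 0) : z ∉ band q := fun h => hz h.1

theorem ne_zero_of_notMem_band (hz : z ∉ band q) : z ≠ 0 := by
  rintro rfl
  simp [band] at hz

theorem isClosed_band : IsClosed (band q) :=
  (isClosed_eq Complex.continuous_re continuous_const).inter
    (isClosed_le (continuous_abs.comp Complex.continuous_im) continuous_const)

theorem compl_band_mem_nhds (hz : z ∉ band q) : (band q)ᶜ ∈ 𝓝 z :=
  isClosed_band.isOpen_compl.mem_nhds hz

theorem isBounded_band : IsBounded (band q) := by
  refine (Metric.isBounded_closedBall (x := (0 : ℂ)) (r := |q|)).subset fun z hz => ?_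
  have := Complex.norm_le_abs_re_add_abs_im z
  rw [hz.1, abs_zero, zero_add] at this
  simpa using this.trans hz.2

theorem compl_band_mem_cobounded : (band q)ᶜ ∈ cobounded ℂ := isBounded_def.1 isBounded_band

theorem one_add_div_sq_mem_slitPlane (hz : z ∉ band q) :
    1 + ((q : ℂ) / z) ^ 2 ∈ Complex.slitPlane := by
  suffices (q / z : ℂ).re ≠ 0 ∨ |(q / z : ℂ).im| < |(1 : ℝ)| by
    simpa [add_comm] using sq_add_sq_mem_slitPlane this
  have hz0 := ne_zero_of_notMem_band hz
  by_cases hzre : z.re = 0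
  · have him : |q| < |z.im| := not_le.1 fun h => hz ⟨hzre, h⟩
    right
    calc |(q / z : ℂ).im| ≤ ‖(q / z : ℂ)‖ := Complex.abs_im_le_norm _
      _ = |q| / ‖z‖ := by rw [norm_div, Complex.norm_real, Real.norm_eq_abs]
      _ < |(1 : ℝ)| := by
        rw [abs_one, div_lt_one (norm_pos_iff.2 hz0)]
        exact him.trans_le (Complex.abs_im_le_norm z)
  · by_cases hq : q = 0
    · simp [hq]
    · left
      simp [Complex.div_re, hq, hzre, hz0]

theorem bandRoot_sq (hz : z ≠ 0) : bandRoot q z ^ 2 = z ^ 2 + q ^ 2 := by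
  rw [bandRoot, mul_pow, sqrt_sq]
  field_simp

theorem norm_bandRoot (hz : z ≠ 0) : ‖bandRoot q z‖ = √‖z ^ 2 + (q : ℂ) ^ 2‖ := by
  rw [← bandRoot_sq hz, norm_pow, Real.sqrt_sq (norm_nonneg _)]

theorem bandRoot_ne_zero (hz : z ∉ band q) : bandRoot q z ≠ 0 := by
  refine mul_ne_zero (ne_zero_of_notMem_band hz) fun h => ?_
  simpa [h] using re_sqrt_pos (one_add_div_sq_mem_slitPlane hz)

theorem bandRoot_neg : bandRoot q (-z) = -bandRoot q z := by
  simp [bandRoot, div_neg]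

theorem bandRoot_conj (hz : z ∉ band q) : bandRoot q (conj z) = conj (bandRoot q z) := by
  simp [bandRoot, ← sqrt_conj (one_add_div_sq_mem_slitPlane hz)]

theorem differentiableAt_bandRoot (hz : z ∉ band q) : DifferentiableAt ℂ (bandRoot q) z := by
  have hz0 := ne_zero_of_notMem_band hz
  have := Complex.differentiableAt_sqrt (one_add_div_sq_mem_slitPlane hz)
  exact differentiableAt_id.mul (this.comp z (f := fun z : ℂ => 1 + (q / z) ^ 2)
    (by fun_prop (disch := assumption)))

theorem hasDerivAt_bandRoot (hz : z ∉ band q) :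
    HasDerivAt (bandRoot q) (z / bandRoot q z) z := by
  have hd := (differentiableAt_bandRoot hz).hasDerivAt
  have hsq : (fun z => bandRoot q z ^ 2) =ᶠ[𝓝 z] fun z => z ^ 2 + (q : ℂ) ^ 2 :=
    (eventually_ne_nhds (ne_zero_of_notMem_band hz)).mono fun _ => bandRoot_sq
  have hpoly : HasDerivAt (fun z : ℂ => z ^ 2 + (q : ℂ) ^ 2) (2 * z) z := by
    simpa using (hasDerivAt_pow 2 z).add_const ((q : ℂ) ^ 2)
  have := (hd.fun_pow 2).unique (hpoly.congr_of_eventuallyEq hsq)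
  suffices deriv (bandRoot q) z = z / bandRoot q z from this ▸ hd
  rw [eq_div_iff (bandRoot_ne_zero hz)]
  linear_combination (1 / 2) * this

theorem bandRoot_of_re_pos (hz : 0 < z.re) : bandRoot q z = Complex.sqrt (z ^ 2 + q ^ 2) := by
  have hconn : IsPreconnected {z : ℂ | 0 < z.re} := (convex_halfSpace_re_gt 0).isPreconnected
  refine hconn.eq_of_sq_eq (f := bandRoot q) (g := fun z => Complex.sqrt (z ^ 2 + q ^ 2))
    (y := 1) (fun z (hz : 0 < z.re) => ?_) (fun z (hz : 0 < z.re) => ?_)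
    (fun z (hz : 0 < z.re) => ?_) (fun {z} (hz : 0 < z.re) hzero => ?_) (by simp)
    (by simp [bandRoot]) hz
  · exact (differentiableAt_bandRoot
      (notMem_band_of_re_ne_zero hz.ne')).continuousAt.continuousWithinAt
  · exact (continuousAt_sqrt_sq_add_sq (Or.inl hz.ne')).continuousWithinAt
  · change bandRoot q z ^ 2 = Complex.sqrt (z ^ 2 + q ^ 2) ^ 2
    rw [sqrt_sq, bandRoot_sq (ne_zero_of_notMem_band (notMem_band_of_re_ne_zero hz.ne' (q := q)))]
  · simpa [hzero] using re_sqrt_pos (sq_add_sq_mem_slitPlane (q := q) (Or.inl hz.ne'))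

theorem bandRoot_of_re_neg (hz : z.re < 0) :
    bandRoot q z = -Complex.sqrt (z ^ 2 + q ^ 2) := by
  have := bandRoot_of_re_pos (q := q) (z := -z) (by simpa using hz)
  rw [← neg_sq, ← this, bandRoot_neg, neg_neg]

theorem tendsto_bandRoot_right (hw : |w.im| < |q|) :
    Tendsto (bandRoot q) (𝓝[{z | 0 < z.re}] w) (𝓝 (Complex.sqrt (w ^ 2 + q ^ 2))) := by
  refine ((continuousAt_sqrt_sq_add_sq (Or.inr hw)).tendsto.mono_left nhdsWithin_le_nhds).congr' ?_
  filter_upwards [self_mem_nhdsWithin] with z hz using (bandRoot_of_re_pos hz).symm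

theorem tendsto_bandRoot_left (hw : |w.im| < |q|) :
    Tendsto (bandRoot q) (𝓝[{z | z.re < 0}] w) (𝓝 (-Complex.sqrt (w ^ 2 + q ^ 2))) := by
  refine ((continuousAt_sqrt_sq_add_sq (Or.inr hw)).neg.tendsto.mono_left
    nhdsWithin_le_nhds).congr' ?_
  filter_upwards [self_mem_nhdsWithin] with z hz using (bandRoot_of_re_neg hz).symm

theorem tendsto_sqrt_one_add_div_sq_cobounded :
    Tendsto (fun z : ℂ => Complex.sqrt (1 + (q / z) ^ 2)) (cobounded ℂ) (𝓝 1) := by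
  have hinner : Tendsto (fun z : ℂ => 1 + (q / z) ^ 2) (cobounded ℂ) (𝓝 1) := by
    simpa [div_eq_mul_inv] using
      ((tendsto_inv₀_cobounded (α := ℂ)).const_mul (q : ℂ)).pow 2 |>.const_add 1
  have hsqrt := (Complex.differentiableAt_sqrt Complex.one_mem_slitPlane).continuousAt.tendsto
  rw [Complex.sqrt_one] at hsqrt
  exact hsqrt.comp hinner

theorem tendsto_bandRoot_of_sq_eq_neg_sq (hq : q ≠ 0) (hw : w ^ 2 = -q ^ 2) :
    Tendsto (bandRoot q) (𝓝 w) (𝓝 0) := by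
  have hw0 : w ≠ 0 := by
    rintro rfl
    simp_all
  rw [tendsto_zero_iff_norm_tendsto_zero]
  have : Tendsto (fun z : ℂ => √‖z ^ 2 + (q : ℂ) ^ 2‖) (𝓝 w) (𝓝 √‖w ^ 2 + (q : ℂ) ^ 2‖) :=
    Continuous.tendsto (by fun_prop) w
  rw [hw, neg_add_cancel, norm_zero, Real.sqrt_zero] at this
  exact this.congr' ((eventually_ne_nhds hw0).mono fun _ hz => (norm_bandRoot hz).symm)

end BandRoot

section BoxArc

variable {q L x t : ℝ} {hq : 0 < q}

/-- The coordinates `(s, δ)` in which the one-sided limits at `boxArc q` are taken: `s` is the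
parameter along the arc and `δ` the signed distance to its left, in units of the velocity. -/
def boxArcChart (q : ℝ) (hq : q ≠ 0) : ℝ × ℝ ≃ₜ ℂ where
  toFun p := ⟨-(2 * q * p.2), q * (2 * p.1 - 1)⟩
  invFun z := ((z.im / q + 1) / 2, -z.re / (2 * q))
  left_inv p := by ext <;> simp <;> field_simp; ring
  right_inv z := by apply Complex.ext <;> simp <;> field_simp; ring
  continuous_toFun := by
    simp only [Complex.mk_eq_add_mul_I]
    fun_prop
  continuous_invFun := by fun_prop

theorem boxArc_eq_boxArcChart (s : ℝ) : (boxArc q hq).toFun s = boxArcChart q hq.ne' (s, 0) := by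
  apply Complex.ext <;> simp [boxArc, boxArcChart]

theorem boxArc_add_normal (s δ : ℝ) :
    (boxArc q hq).toFun s + (δ : ℂ) * (Complex.I * deriv (boxArc q hq).toFun s)
      = boxArcChart q hq.ne' (s, δ) := by
  have hd : HasDerivAt (boxArc q hq).toFun (((q * (2 * 1) : ℝ) : ℂ) * Complex.I) s :=
    ((((hasDerivAt_id s).const_mul 2).sub_const 1).const_mul q).ofReal_comp.mul_const Complex.I
  rw [hd.deriv, boxArc_eq_boxArcChart]
  apply Complex.ext <;> simp [boxArcChart]
  ring

theorem boxArc_image (S : Set ℝ) :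
    (boxArc q hq).toFun '' S = {z | z.re = 0 ∧ (z.im / q + 1) / 2 ∈ S} := by
  ext z
  simp only [boxArc_eq_boxArcChart, mem_image, ← (boxArcChart q hq.ne').eq_symm_apply]
  have hre : 0 = -z.re / (2 * q) ↔ z.re = 0 := by simp [eq_comm (a := (0 : ℝ)), hq.ne']
  simp [boxArcChart, and_comm, hre]

theorem boxContour_support : (boxContour q hq).support = band q := by
  have hmem (y : ℝ) : (y / q + 1) / 2 ∈ Icc (0 : ℝ) 1 ↔ |y| ≤ |q| := by
    rw [← div_le_one (abs_pos.2 hq.ne'), ← abs_div, abs_le, mem_Icc]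
    constructor <;> rintro ⟨_, _⟩ <;> constructor <;> linarith
  simp [Contour.support, boxContour, Arc.trace, boxArc_image, hmem, band, iUnion_const]

theorem boxArc_inner : (boxArc q hq).inner = {z | z.re = 0 ∧ |z.im| < |q|} := by
  have hmem (y : ℝ) : (y / q + 1) / 2 ∈ Ioo (0 : ℝ) 1 ↔ |y| < |q| := by
    rw [← div_lt_one (abs_pos.2 hq.ne'), ← abs_div, abs_lt, mem_Ioo]
    constructor <;> rintro ⟨_, _⟩ <;> constructor <;> linarith
  simp only [Arc.inner, boxArc_image, hmem]

theorem forall_boxArc_iff {P : ℂ → Prop} :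
    (∀ s ∈ Ioo (0 : ℝ) 1, P ((boxArc q hq).toFun s)) ↔ ∀ w : ℂ, w.re = 0 → |w.im| < |q| → P w := by
  rw [← forall_mem_image, show (boxArc q hq).toFun '' Ioo 0 1 = _ from boxArc_inner]
  simp only [mem_ofPred_eq, and_imp]

theorem map_boxArcChart (s : ℝ) (S : Set ℝ) :
    map (boxArcChart q hq.ne') (𝓝 s ×ˢ 𝓝[S] 0)
      = 𝓝[{z | -z.re / (2 * q) ∈ S}] ((boxArc q hq).toFun s) := by
  rw [← nhdsWithin_univ, ← nhdsWithin_prod_eq, boxArc_eq_boxArcChart,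
    (boxArcChart q hq.ne').isEmbedding.map_nhdsWithin_eq, Homeomorph.image_eq_preimage_symm]
  simp [boxArcChart, preimage]

theorem boxArc_hasLeftValue_iff {g : ℂ → ℂ} {s : ℝ} {c : ℂ} :
    (boxArc q hq).HasLeftValue g s c ↔
      Tendsto g (𝓝[{z | z.re < 0}] ((boxArc q hq).toFun s)) (𝓝 c) := by
  have hside : {z : ℂ | -z.re / (2 * q) ∈ Ioi 0} = {z | z.re < 0} := by
    ext z
    simp [div_pos_iff_of_pos_right, hq]
  rw [← hside, ← map_boxArcChart, tendsto_map'_iff]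
  simp only [Arc.HasLeftValue, boxArc_add_normal]
  rfl

theorem boxArc_hasRightValue_iff {g : ℂ → ℂ} {s : ℝ} {c : ℂ} :
    (boxArc q hq).HasRightValue g s c ↔
      Tendsto g (𝓝[{z | 0 < z.re}] ((boxArc q hq).toFun s)) (𝓝 c) := by
  have hside : {z : ℂ | -z.re / (2 * q) ∈ Iio 0} = {z | 0 < z.re} := by
    ext z
    simp [div_neg_iff, hq, hq.le]
  rw [← hside, ← map_boxArcChart, tendsto_map'_iff]
  simp only [Arc.HasRightValue, boxArc_add_normal]
  rfl

theorem isBoxGFunction_iff {g : ℂ → ℂ} :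
    IsBoxGFunction q L hq x t g ↔
      DifferentiableOn ℂ g (band q)ᶜ ∧ (∃ c, Tendsto g (Bornology.cobounded ℂ) (𝓝 c)) ∧
      (∃ B : ℝ, ∀ z ∈ (band q)ᶜ, ‖g z‖ ≤ B) ∧ (∀ z ∈ (band q)ᶜ, g (conj z) = conj (g z)) ∧
      ∀ w : ℂ, w.re = 0 → |w.im| < |q| → ∃ a b, Tendsto g (𝓝[{z | z.re < 0}] w) (𝓝 a) ∧
        Tendsto g (𝓝[{z | 0 < z.re}] w) (𝓝 b) ∧ a + b = inputF (boxF₀ L) w x t := by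
  rw [← boxContour_support (hq := hq), ← forall_boxArc_iff (hq := hq)]
  simp only [← boxArc_hasLeftValue_iff, ← boxArc_hasRightValue_iff]
  refine ⟨fun hg => ⟨hg.analytic, hg.analytic_infinity, hg.bounded, hg.symm, fun s hs => ?_⟩,
    fun ⟨hd, hlim, hB, hsymm, hjump⟩ => ?_⟩
  · obtain ⟨a, b, ha, hb, hab⟩ := hg.jump_main 0 s ⟨hs, Finset.notMem_empty s⟩
    exact ⟨a, b, ha, hb, by simpa [boxContour] using hab⟩
  · exact
    { analytic_input := fun _ _ _ => by unfold boxF₀; fun_prop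
      symm_input := fun z _ => by simp [boxF₀, Complex.conj_ofNat]
      analytic := hd
      analytic_infinity := hlim
      bounded := hB
      symm := hsymm
      normalized := rfl
      jump_main := fun _ s hreg => by
        obtain ⟨a, b, ha, hb, hab⟩ := hjump s hreg.1
        exact ⟨a, b, ha, hb, by simpa [boxContour] using hab⟩
      jump_gap := fun k => k.elim0
      modulation := fun i e he hsoft => by
        have : e = -(q * Complex.I) ∨ e = q * Complex.I := by
          norm_num [Arc.endpoints, boxContour, boxArc] at he
          exact he
        simp_all }

end BoxArc

section Existence

open Bornology

theorem exists_norm_le_of_tendsto_cobounded {X E : Type*} [PseudoMetricSpace X] [ProperSpace X]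
    [SeminormedAddCommGroup E] {f : X → E} {M : X → ℝ} {c : E} (hM : Continuous M)
    (hf : ∀ z, ‖f z‖ ≤ M z) (hlim : Tendsto f (cobounded X) (𝓝 c)) : ∃ B, ∀ z, ‖f z‖ ≤ B := by
  have hfar : IsBounded {z | ‖f z‖ < ‖c‖ + 1}ᶜ :=
    isBounded_def.2 <| by
      rw [compl_compl]
      exact hlim.norm.eventually_lt_const (lt_add_one ‖c‖)
  obtain ⟨B, hB⟩ := (hfar.isCompact_closure.image hM).bddAbove
  refine ⟨max (‖c‖ + 1) B, fun z => ?_⟩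
  by_cases hz : ‖f z‖ < ‖c‖ + 1
  · exact hz.le.trans (le_max_left _ _)
  · exact (hf z).trans ((hB (mem_image_of_mem M (subset_closure hz))).trans (le_max_right _ _))

variable {q L x t : ℝ} {z w : ℂ}

/-- The genus zero `g`-function of the box potential. -/
def boxG (q L x t : ℝ) (z : ℂ) : ℂ := (t * z - (L - x)) * (z - bandRoot q z)

theorem boxG_eq_div (hz : z ∉ band q) :
    boxG q L x t z
      = -(t - (L - x) / z) * q ^ 2 / (1 + Complex.sqrt (1 + (q / z) ^ 2)) := by
  have hz0 := ne_zero_of_notMem_band hz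
  have hre := re_sqrt_pos (one_add_div_sq_mem_slitPlane hz)
  have hne : 1 + Complex.sqrt (1 + (q / z) ^ 2) ≠ 0 := fun h => by
    have := congrArg Complex.re h
    simp only [Complex.add_re, Complex.one_re, Complex.zero_re] at this
    linarith
  have hsq := bandRoot_sq (q := q) hz0
  rw [boxG, eq_div_iff hne]
  rw [bandRoot] at hsq ⊢
  generalize Complex.sqrt (1 + (q / z) ^ 2) = S at hsq ⊢
  field_simp
  linear_combination -(t * z - (L - x)) * hsq

theorem tendsto_boxG_cobounded :
    Tendsto (boxG q L x t) (cobounded ℂ) (𝓝 (-t * q ^ 2 / 2)) := by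
  have hquot : Tendsto (fun z : ℂ => -((t : ℂ) - (L - x) / z) * q ^ 2
      / (1 + Complex.sqrt (1 + (q / z) ^ 2))) (cobounded ℂ)
      (𝓝 (-((t : ℂ) - (L - x) * 0) * q ^ 2 / (1 + 1))) := by
    refine Tendsto.div ?_ (tendsto_sqrt_one_add_div_sq_cobounded.const_add 1) (by norm_num)
    exact ((tendsto_inv₀_cobounded.const_mul _).const_sub _).neg.mul_const _
  rw [mul_zero, sub_zero, one_add_one_eq_two] at hquot
  refine hquot.congr' ?_
  filter_upwards [compl_band_mem_cobounded] with z hz using (boxG_eq_div hz).symm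

theorem exists_norm_boxG_le (q L x t : ℝ) : ∃ B : ℝ, ∀ z, ‖boxG q L x t z‖ ≤ B := by
  refine exists_norm_le_of_tendsto_cobounded (by fun_prop) (fun z => ?_)
    (tendsto_boxG_cobounded (q := q) (L := L) (x := x) (t := t))
    (M := fun z => ‖(t : ℂ) * z - (L - x)‖ * (‖z‖ + √‖z ^ 2 + (q : ℂ) ^ 2‖))
  have hroot : ‖bandRoot q z‖ ≤ √‖z ^ 2 + (q : ℂ) ^ 2‖ := by
    rcases eq_or_ne z 0 with rfl | hz
    · simp [bandRoot]
    · exact (norm_bandRoot hz).le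
  rw [boxG, norm_mul]
  gcongr
  exact (norm_sub_le _ _).trans (by gcongr)

theorem tendsto_boxG (l : Filter ℂ) {r : ℂ} (hl : l ≤ 𝓝 w) (hr : Tendsto (bandRoot q) l (𝓝 r)) :
    Tendsto (boxG q L x t) l (𝓝 ((t * w - (L - x)) * (w - r))) := by
  have hid : Tendsto (fun z : ℂ => z) l (𝓝 w) := hl
  exact ((hid.const_mul (t : ℂ)).sub_const _).mul (hid.sub hr)

theorem isBoxGFunction_boxG {hq : 0 < q} : IsBoxGFunction q L hq x t (boxG q L x t) := by
  refine isBoxGFunction_iff.2 ⟨fun z hz => ?_, ⟨_, tendsto_boxG_cobounded⟩, ?_, fun z hz => ?_,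
    fun w _ hw => ⟨_, _, tendsto_boxG _ nhdsWithin_le_nhds (tendsto_bandRoot_left hw),
      tendsto_boxG _ nhdsWithin_le_nhds (tendsto_bandRoot_right hw), ?_⟩⟩
  · have := differentiableAt_bandRoot hz
    unfold boxG
    exact DifferentiableAt.differentiableWithinAt (by fun_prop)
  · obtain ⟨B, hB⟩ := exists_norm_boxG_le q L x t
    exact ⟨B, fun z _ => hB z⟩
  · simp [boxG, bandRoot_conj hz]
  · rw [inputF, boxF₀]
    ring

end Existence

section Uniqueness

open Asymptotics Bornology

variable {q L x t : ℝ} {w : ℂ} {d : ℂ → ℂ} {B : ℝ}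

theorem nhdsWithin_compl_band_le (hw : |w.im| < |q|) :
    𝓝[(band q)ᶜ] w ≤ 𝓝[{z | z.re < 0}] w ⊔ 𝓝[{z | 0 < z.re}] w := by
  rw [← nhdsWithin_union, nhdsWithin_le_iff]
  have hnear : {z : ℂ | |z.im| < |q|} ∈ 𝓝 w :=
    (isOpen_lt (continuous_abs.comp Complex.continuous_im) continuous_const).mem_nhds hw
  filter_upwards [mem_nhdsWithin_of_mem_nhds hnear, self_mem_nhdsWithin] with z hzim hzband
  exact lt_or_gt_of_ne fun hre => hzband ⟨hre, hzim.le⟩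

theorem tendsto_mul_bandRoot_of_opposite_boundary_values {c : ℂ} (hw : |w.im| < |q|)
    (hleft : Tendsto d (𝓝[{z | z.re < 0}] w) (𝓝 c))
    (hright : Tendsto d (𝓝[{z | 0 < z.re}] w) (𝓝 (-c))) :
    Tendsto (fun z => d z * bandRoot q z) (𝓝[(band q)ᶜ] w)
      (𝓝 (-c * Complex.sqrt (w ^ 2 + q ^ 2))) := by
  refine Tendsto.mono_left (Tendsto.sup ?_ ?_) (nhdsWithin_compl_band_le hw)
  · simpa using hleft.mul (tendsto_bandRoot_left hw)
  · exact hright.mul (tendsto_bandRoot_right hw)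

theorem tendsto_mul_bandRoot_of_sq_eq_neg_sq (hq : q ≠ 0) (hB : ∀ z ∈ (band q)ᶜ, ‖d z‖ ≤ B)
    (hw : w ^ 2 = -q ^ 2) :
    Tendsto (fun z => d z * bandRoot q z) (𝓝[(band q)ᶜ] w) (𝓝 0) :=
  isBoundedUnder_le_mul_tendsto_zero
    (isBoundedUnder_of_eventually_le (eventually_mem_nhdsWithin.mono hB))
    ((tendsto_bandRoot_of_sq_eq_neg_sq hq hw).mono_left nhdsWithin_le_nhds)

theorem bandRoot_isBigO_id : bandRoot q =O[cobounded ℂ] fun z : ℂ => z := by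
  have hsqrt : (fun z : ℂ => Complex.sqrt (1 + (q / z) ^ 2)) =O[cobounded ℂ] fun _ => (1 : ℂ) :=
    tendsto_sqrt_one_add_div_sq_cobounded.isBigO_one ℂ
  exact ((isBigO_refl (fun z : ℂ => z) (cobounded ℂ)).mul hsqrt).congr_right fun z => mul_one z

theorem sq_eq_neg_sq_of_mem_band (hw : w ∈ band q) (him : |q| ≤ |w.im|) : w ^ 2 = -q ^ 2 := by
  have hsq : w.im ^ 2 = q ^ 2 := (sq_eq_sq_iff_abs_eq_abs _ _).2 (hw.2.antisymm him)
  rw [← Complex.re_add_im w, hw.1, ← Complex.ofReal_pow, ← hsq]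
  simp [mul_pow]

theorem eq_zero_of_opposite_boundary_values (hq : q ≠ 0) (hd : DifferentiableOn ℂ d (band q)ᶜ)
    (hB : ∀ z ∈ (band q)ᶜ, ‖d z‖ ≤ B)
    (hjump : ∀ w : ℂ, w.re = 0 → |w.im| < |q| → ∃ c,
      Tendsto d (𝓝[{z | z.re < 0}] w) (𝓝 c) ∧ Tendsto d (𝓝[{z | 0 < z.re}] w) (𝓝 (-c))) :
    EqOn d 0 (band q)ᶜ := by
  -- The square root changes sign across the band as well, so the product has no jump.
  set Φ := fun z => d z * bandRoot q z
  have hΦ : DifferentiableOn ℂ Φ (band q)ᶜ :=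
    hd.mul fun z hz => (differentiableAt_bandRoot hz).differentiableWithinAt
  have hentire : Differentiable ℂ (extendFrom (band q)ᶜ Φ) := by
    refine differentiable_extendFrom_compl isClosed_band (fun z hz => hz.1) hΦ fun w hw => ?_
    rcases lt_or_ge |w.im| |q| with him | him
    · obtain ⟨c, hleft, hright⟩ := hjump w hw.1 him
      exact ⟨_, tendsto_mul_bandRoot_of_opposite_boundary_values him hleft hright⟩
    · exact ⟨0, tendsto_mul_bandRoot_of_sq_eq_neg_sq hq hB (sq_eq_neg_sq_of_mem_band hw him)⟩
  have hagree : EqOn (extendFrom (band q)ᶜ Φ) Φ (band q)ᶜ :=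
    extendFrom_extends hΦ.continuousOn
  have hroot {w : ℂ} (hw : w ^ 2 = -q ^ 2) : extendFrom (band q)ᶜ Φ w = 0 :=
    extendFrom_eq (dense_compl_of_forall_re_eq (fun z hz => hz.1) w)
      (tendsto_mul_bandRoot_of_sq_eq_neg_sq hq hB hw)
  have hgrowth : extendFrom (band q)ᶜ Φ =o[cobounded ℂ] fun z => z ^ 2 := by
    have hbounded : d =O[cobounded ℂ] fun _ => (1 : ℂ) :=
      IsBigO.of_bound B <| by
        filter_upwards [compl_band_mem_cobounded] with z hz
        simpa using hB z hz
    have hΦz : Φ =O[cobounded ℂ] fun z => z := by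
      simpa using hbounded.mul (bandRoot_isBigO_id (q := q))
    refine (hΦz.trans_isLittleO ?_).congr' ?_ .rfl
    · simpa using isLittleO_pow_pow_cobounded_of_lt (R := ℂ) one_lt_two
    · filter_upwards [compl_band_mem_cobounded] with z hz using (hagree hz).symm
  have hne : (q * Complex.I : ℂ) ≠ -(q * Complex.I) := by simp [self_eq_neg, hq]
  have hzero := eq_zero_of_isLittleO_sq hentire hne (hroot (by simp [mul_pow]))
    (hroot (by simp [mul_pow])) hgrowth
  intro z hz
  have := hagree hz
  rw [hzero] at this
  exact (mul_eq_zero.1 this.symm).resolve_right (bandRoot_ne_zero hz)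

theorem eqOn_boxG_of_isBoxGFunction {hq : 0 < q} {g : ℂ → ℂ} (hg : IsBoxGFunction q L hq x t g) :
    EqOn g (boxG q L x t) (band q)ᶜ := by
  obtain ⟨hd, -, ⟨B, hB⟩, -, hjump⟩ := isBoxGFunction_iff.1 hg
  obtain ⟨hd', -, ⟨B', hB'⟩, -, hjump'⟩ :=
    isBoxGFunction_iff.1 (isBoxGFunction_boxG (hq := hq) (L := L) (x := x) (t := t))
  have hdiff := eq_zero_of_opposite_boundary_values hq.ne' (hd.sub hd')
    (fun z hz => (norm_sub_le _ _).trans (add_le_add (hB z hz) (hB' z hz))) fun w hre him => by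
      obtain ⟨a, b, ha, hb, hab⟩ := hjump w hre him
      obtain ⟨a', b', ha', hb', hab'⟩ := hjump' w hre him
      refine ⟨a - a', ha.sub ha', ?_⟩
      rw [show -(a - a') = b - b' by linear_combination hab' - hab]
      exact hb.sub hb'
  exact fun z hz => sub_eq_zero.1 (hdiff hz)

end Uniqueness

section BoxDoublePoints

variable {q L x t : ℝ} {z w : ℂ}

/-- The phase `h = 2g - f` of the box potential in genus zero, off the band. -/
def boxPhase (q L x t : ℝ) (z : ℂ) : ℂ := -2 * (t * z - (L - x)) * bandRoot q z

theorem phaseH_eqOn_boxPhase {hq : 0 < q} {g : ℝ → ℝ → ℂ → ℂ}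
    (hg : IsBoxGFunction q L hq x t (g x t)) :
    EqOn (fun z => phaseH (boxF₀ L) g z x t) (boxPhase q L x t) (band q)ᶜ := by
  intro z hz
  simp only [phaseH, eqOn_boxG_of_isBoxGFunction hg hz, boxG, inputF, boxF₀, boxPhase]
  ring

theorem hasDerivAt_boxPhase (hz : z ∉ band q) :
    HasDerivAt (boxPhase q L x t)
      (-2 * (2 * t * z ^ 2 - (L - x) * z + t * q ^ 2) / bandRoot q z) z := by
  have hlinear : HasDerivAt (fun w : ℂ => -2 * (t * w - (L - x))) (-2 * (t * 1)) z :=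
    (((hasDerivAt_id z).const_mul (t : ℂ)).sub_const _).const_mul (-2)
  refine (hlinear.mul (hasDerivAt_bandRoot hz)).congr_deriv ?_
  have hsq := bandRoot_sq (q := q) (ne_zero_of_notMem_band hz)
  have hne := bandRoot_ne_zero hz
  field_simp
  linear_combination -t * hsq

theorem deriv_and_iteratedDeriv_two_eq_zero_iff {𝕜 : Type*} [NontriviallyNormedField 𝕜]
    {f N R : 𝕜 → 𝕜} {a N' R' : 𝕜} (hf : deriv f =ᶠ[𝓝 a] fun b => N b / R b)
    (hN : HasDerivAt N N' a) (hR : HasDerivAt R R' a) (hRa : R a ≠ 0) :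
    deriv f a = 0 ∧ iteratedDeriv 2 f a = 0 ↔ N a = 0 ∧ N' = 0 := by
  have hsecond : iteratedDeriv 2 f a = (N' * R a - N a * R') / R a ^ 2 := by
    rw [iteratedDeriv_succ, iteratedDeriv_one]
    exact ((hN.div hR hRa).congr_of_eventuallyEq hf).deriv
  rw [hf.self_of_nhds, hsecond, div_eq_zero_iff, or_iff_left hRa]
  refine and_congr_right fun hNa => ?_
  simp [hNa, hRa]

theorem boxPhase_critical_iff (hz : z ∉ band q) :
    deriv (boxPhase q L x t) z = 0 ∧ iteratedDeriv 2 (boxPhase q L x t) z = 0 ↔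
      2 * t * z ^ 2 - (L - x) * z + t * q ^ 2 = 0 ∧ 4 * t * z = L - x := by
  have hderiv : deriv (boxPhase q L x t) =ᶠ[𝓝 z] fun w =>
      -2 * (2 * t * w ^ 2 - (L - x) * w + t * q ^ 2) / bandRoot q w := by
    filter_upwards [compl_band_mem_nhds hz] with w hw using (hasDerivAt_boxPhase hw).deriv
  have hN : HasDerivAt (fun w : ℂ => -2 * (2 * t * w ^ 2 - (L - x) * w + t * (q : ℂ) ^ 2))
      (-2 * (4 * t * z - (L - x))) z := by
    have := ((((hasDerivAt_pow 2 z).const_mul (2 * t : ℂ)).sub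
      ((hasDerivAt_id z).const_mul ((L : ℂ) - x))).add_const ((t : ℂ) * (q : ℂ) ^ 2)).const_mul (-2)
    refine this.congr_deriv ?_
    norm_num
    ring
  rw [deriv_and_iteratedDeriv_two_eq_zero_iff hderiv hN (hasDerivAt_bandRoot hz)
    (bandRoot_ne_zero hz)]
  simp [sub_eq_zero (b := (L : ℂ) - x)]

theorem eq_zero_of_continuousAt_mul_bandRoot {f φ : ℂ → ℂ} (hre : w.re = 0) (him : |w.im| < |q|)
    (hf : ContinuousAt f w) (hφ : ContinuousAt φ w)
    (hfφ : EqOn f (fun z => φ z * bandRoot q z) (band q)ᶜ) : φ w = 0 := by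
  have hright : Tendsto f (𝓝[{z | 0 < z.re}] w) (𝓝 (φ w * Complex.sqrt (w ^ 2 + q ^ 2))) := by
    refine ((hφ.mono_left nhdsWithin_le_nhds).mul (tendsto_bandRoot_right him)).congr' ?_
    filter_upwards [self_mem_nhdsWithin] with z hz
      using (hfφ (notMem_band_of_re_ne_zero (ne_of_gt hz))).symm
  have hleft : Tendsto f (𝓝[{z | z.re < 0}] w) (𝓝 (φ w * -Complex.sqrt (w ^ 2 + q ^ 2))) := by
    refine ((hφ.mono_left nhdsWithin_le_nhds).mul (tendsto_bandRoot_left him)).congr' ?_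
    filter_upwards [self_mem_nhdsWithin] with z hz
      using (hfφ (notMem_band_of_re_ne_zero (ne_of_lt hz))).symm
  have : (𝓝[{z | 0 < z.re}] w).NeBot := mem_closure_iff_nhdsWithin_neBot.1 <| by
    simp [Complex.closure_setOfPred_lt_re, hre]
  have : (𝓝[{z | z.re < 0}] w).NeBot := mem_closure_iff_nhdsWithin_neBot.1 <| by
    simp [Complex.closure_setOfPred_re_lt, hre]
  have hr := tendsto_nhds_unique hright (hf.mono_left nhdsWithin_le_nhds)
  have hl := tendsto_nhds_unique hleft (hf.mono_left nhdsWithin_le_nhds)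
  rw [mul_neg] at hl
  refine (mul_eq_zero.1 (self_eq_neg.1 (hr.trans hl.symm))).resolve_right fun hsqrt => ?_
  simpa [hsqrt] using re_sqrt_pos (sq_add_sq_mem_slitPlane (Or.inr him))

theorem not_continuousAt_zero_of_eqOn_boxPhase (hq : q ≠ 0) (hx : x ≠ L) {f : ℂ → ℂ}
    (hf : EqOn f (boxPhase q L x t) (band q)ᶜ) : ¬ContinuousAt f 0 := by
  intro hc
  have := eq_zero_of_continuousAt_mul_bandRoot (φ := fun z => -2 * (t * z - (L - x)))
    Complex.zero_re (by simpa using hq) hc (by fun_prop) hf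
  simp [sub_eq_zero, hx] at this

theorem isRealDoublePoint_congr {f₁ f₂ : ℂ → ℂ} {z₀ : ℝ} (h : f₁ =ᶠ[𝓝 (z₀ : ℂ)] f₂) :
    IsRealDoublePoint f₁ z₀ ↔ IsRealDoublePoint f₂ z₀ := by
  rw [IsRealDoublePoint, IsRealDoublePoint, analyticAt_congr h, h.deriv_eq, h.iteratedDeriv_eq]

theorem analyticAt_boxPhase (hz : z ∉ band q) : AnalyticAt ℂ (boxPhase q L x t) z :=
  DifferentiableOn.analyticAt (s := (band q)ᶜ)
    (fun _ hw => (hasDerivAt_boxPhase hw).differentiableAt.differentiableWithinAt)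
    (compl_band_mem_nhds hz)

theorem isRealDoublePoint_iff_of_eqOn_boxPhase (hq : q ≠ 0) (hx : x ≠ L) {f : ℂ → ℂ}
    (hf : EqOn f (boxPhase q L x t) (band q)ᶜ) (z₀ : ℝ) :
    IsRealDoublePoint f z₀ ↔
      2 * t * z₀ ^ 2 - (L - x) * z₀ + t * q ^ 2 = 0 ∧ 4 * t * z₀ = L - x := by
  rcases eq_or_ne z₀ 0 with rfl | hz₀
  · refine iff_of_false (fun hD => ?_) fun hcrit => ?_
    · exact not_continuousAt_zero_of_eqOn_boxPhase hq hx hf (by simpa using hD.1.continuousAt)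
    · exact hx (by linarith [hcrit.2])
  · have hz : (z₀ : ℂ) ∉ band q := notMem_band_of_re_ne_zero (by simpa using hz₀)
    rw [isRealDoublePoint_congr (hf.eventuallyEq_of_mem (compl_band_mem_nhds hz)),
      IsRealDoublePoint, and_iff_right (analyticAt_boxPhase hz), boxPhase_critical_iff hz]
    norm_cast

theorem critical_equations_iff {v z₀ : ℝ} (hq : 0 < q) (hv : 0 < v) :
    2 * z₀ ^ 2 - v * z₀ + q ^ 2 = 0 ∧ 4 * z₀ = v ↔ v = 2 * √2 * q ∧ z₀ = q / √2 := by
  have hsqrt : √2 ^ 2 = 2 := Real.sq_sqrt zero_le_two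
  rw [eq_div_iff (by positivity)]
  constructor
  · rintro ⟨hcrit, rfl⟩
    have hq' : q = z₀ * √2 := by
      rw [← sq_eq_sq₀ hq.le (mul_nonneg (by linarith) (Real.sqrt_nonneg 2)), mul_pow, hsqrt]
      linear_combination hcrit
    exact ⟨by rw [hq']; linear_combination -2 * z₀ * hsqrt, hq'.symm⟩
  · rintro ⟨rfl, rfl⟩
    exact ⟨by linear_combination -z₀ ^ 2 * hsqrt, by linear_combination -2 * z₀ * hsqrt⟩

theorem isRealDoublePoint_iff_of_div_pos (hq : 0 < q) (hv : 0 < (L - x) / t) {f : ℂ → ℂ}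
    (hf : EqOn f (boxPhase q L x t) (band q)ᶜ) (z₀ : ℝ) :
    IsRealDoublePoint f z₀ ↔ (L - x) / t = 2 * √2 * q ∧ z₀ = q / √2 := by
  obtain ⟨hLx, ht⟩ := div_ne_zero_iff.1 hv.ne'
  rw [isRealDoublePoint_iff_of_eqOn_boxPhase hq.ne' (sub_ne_zero.1 hLx).symm hf,
    ← critical_equations_iff hq hv]
  refine and_congr ?_ (by rw [eq_div_iff ht, mul_right_comm])
  have hscale : 2 * t * z₀ ^ 2 - (L - x) * z₀ + t * q ^ 2
      = t * (2 * z₀ ^ 2 - (L - x) / t * z₀ + q ^ 2) := by field_simp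
  rw [hscale, mul_eq_zero_iff_left ht]

variable {h : ℂ → ℝ → ℝ → ℂ}

theorem potP_eqOn_bandRoot
    (hh : ∀ᶠ p : ℝ × ℝ in 𝓝 (x, t),
      EqOn (fun z => h z p.1 p.2) (boxPhase q L p.1 p.2) (band q)ᶜ) :
    EqOn (fun z => potP h z x t) (bandRoot q) (band q)ᶜ := by
  intro z hz
  have hphase : HasDerivAt (fun x' : ℝ => boxPhase q L x' t z) (-2 * bandRoot q z) x := by
    simpa [boxPhase] using (((((hasDerivAt_id x).ofReal_comp.const_sub (L : ℂ)).const_sub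
      ((t : ℂ) * z)).const_mul (-2 : ℂ)).mul_const (bandRoot q z))
  have hslice := (Continuous.prodMk_left t).tendsto x |>.eventually hh
  have := hphase.congr_of_eventuallyEq (f₁ := fun x' => h z x' t)
    (hslice.mono fun _ h => h hz)
  simp [potP, this.deriv]

theorem potQ_eqOn_mul_bandRoot
    (hh : ∀ᶠ p : ℝ × ℝ in 𝓝 (x, t),
      EqOn (fun z => h z p.1 p.2) (boxPhase q L p.1 p.2) (band q)ᶜ) :
    EqOn (fun z => potQ h z x t) (fun z => z * bandRoot q z) (band q)ᶜ := by
  intro z hz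
  have hphase : HasDerivAt (fun t' : ℝ => boxPhase q L x t' z) (-2 * z * bandRoot q z) t := by
    simpa [boxPhase] using (((((hasDerivAt_id t).ofReal_comp.mul_const z).sub_const
      ((L : ℂ) - x)).const_mul (-2 : ℂ)).mul_const (bandRoot q z))
  have hslice := (Continuous.prodMk_right x).tendsto t |>.eventually hh
  have := hphase.congr_of_eventuallyEq (f₁ := fun t' => h z x t')
    (hslice.mono fun _ h => h hz)
  simp [potQ, this.deriv, mul_assoc]

theorem dpCoeff_eq_div_bandRoot
    (hh : ∀ᶠ p : ℝ × ℝ in 𝓝 (x, t),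
      EqOn (fun z => h z p.1 p.2) (boxPhase q L p.1 p.2) (band q)ᶜ) (hz : z ∉ band q) :
    dpCoeff h z x t = z / bandRoot q z :=
  ((hasDerivAt_bandRoot hz).congr_of_eventuallyEq <|
    (potP_eqOn_bandRoot hh).eventuallyEq_of_mem (compl_band_mem_nhds hz)).deriv

theorem dqCoeff_eq_div_bandRoot
    (hh : ∀ᶠ p : ℝ × ℝ in 𝓝 (x, t),
      EqOn (fun z => h z p.1 p.2) (boxPhase q L p.1 p.2) (band q)ᶜ) (hz : z ∉ band q) :
    dqCoeff h z x t = (2 * z ^ 2 + q ^ 2) / bandRoot q z := by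
  have hderiv := ((hasDerivAt_id z).mul (hasDerivAt_bandRoot hz)).congr_of_eventuallyEq <|
    (potQ_eqOn_mul_bandRoot hh).eventuallyEq_of_mem (compl_band_mem_nhds hz)
  rw [dqCoeff, hderiv.deriv, id, one_mul, eq_div_iff (bandRoot_ne_zero hz), add_mul, ← pow_two,
    bandRoot_sq (ne_zero_of_notMem_band hz), mul_assoc, div_mul_cancel₀ _ (bandRoot_ne_zero hz)]
  ring

theorem velocity_eq_add_div
    (hh : ∀ᶠ p : ℝ × ℝ in 𝓝 (x, t),
      EqOn (fun z => h z p.1 p.2) (boxPhase q L p.1 p.2) (band q)ᶜ) (hz : z ∉ band q) :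
    velocity h z x t = (2 * z ^ 2 + q ^ 2) / z := by
  rw [velocity, dpCoeff_eq_div_bandRoot hh hz, dqCoeff_eq_div_bandRoot hh hz,
    div_div_div_cancel_right₀ (bandRoot_ne_zero hz)]

theorem dpCoeff_ne_zero_and_velocity_eq (hq : 0 < q)
    (hh : ∀ᶠ p : ℝ × ℝ in 𝓝 (x, t),
      EqOn (fun z => h z p.1 p.2) (boxPhase q L p.1 p.2) (band q)ᶜ) :
    dpCoeff h ((q / √2 : ℝ) : ℂ) x t ≠ 0 ∧
      velocity h ((q / √2 : ℝ) : ℂ) x t = ((2 * √2 * q : ℝ) : ℂ) := by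
  have hpos : 0 < q / √2 := by positivity
  have hz : ((q / √2 : ℝ) : ℂ) ∉ band q := notMem_band_of_re_ne_zero (by simpa using hpos.ne')
  rw [dpCoeff_eq_div_bandRoot hh hz, velocity_eq_add_div hh hz]
  refine ⟨div_ne_zero (ne_zero_of_notMem_band hz) (bandRoot_ne_zero hz), ?_⟩
  have : (2 * (q / √2) ^ 2 + q ^ 2) / (q / √2) = 2 * √2 * q := by
    have hsqrt : √2 ^ 2 = 2 := Real.sq_sqrt zero_le_two
    field_simp
    linear_combination -hsqrt
  exact_mod_cast this

end BoxDoublePoints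

end FocusingNLS

end

theorem mainTheorem8_general :
    (∀ (h : ℂ → ℝ → ℝ → ℂ) (X T : ℝ → ℝ) (Z : ℝ → ℂ) (s₀ : ℝ),
      ContDiffAt ℝ 3 (fun p : ℂ × ℝ × ℝ => h p.1 p.2.1 p.2.2) (Z s₀, X s₀, T s₀) →
      (∀ᶠ p : ℂ × ℝ × ℝ in 𝓝 (Z s₀, X s₀, T s₀), AnalyticAt ℂ (fun w => h w p.2.1 p.2.2) p.1) →
      DifferentiableAt ℝ X s₀ → DifferentiableAt ℝ T s₀ → DifferentiableAt ℝ Z s₀ →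
      (deriv X s₀ ≠ 0 ∨ deriv T s₀ ≠ 0) →
      (∀ᶠ s in 𝓝 s₀, deriv (fun w => h w (X s) (T s)) (Z s) = 0 ∧
        iteratedDeriv 2 (fun w => h w (X s) (T s)) (Z s) = 0) →
      FocusingNLS.dpCoeff h (Z s₀) (X s₀) (T s₀) ≠ 0 →
      deriv T s₀ ≠ 0 ∧
      FocusingNLS.velocity h (Z s₀) (X s₀) (T s₀) = ((-(deriv X s₀ / deriv T s₀) : ℝ) : ℂ) ∧
      (deriv X s₀ ≠ 0 → FocusingNLS.hZZT h (Z s₀) (X s₀) (T s₀) ≠ 0 →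
        ((deriv T s₀ / deriv X s₀ : ℝ) : ℂ) =
          -(FocusingNLS.hZZZ h (Z s₀) (X s₀) (T s₀) * (deriv Z s₀ / deriv X s₀)
              + FocusingNLS.hZZX h (Z s₀) (X s₀) (T s₀))
            / FocusingNLS.hZZT h (Z s₀) (X s₀) (T s₀))) ∧
    (∀ (q L : ℝ) (hq : 0 < q),
      (∃ g : ℝ → ℝ → ℂ → ℂ, ∀ x t : ℝ, FocusingNLS.IsBoxGFunction q L hq x t (g x t)) ∧
      ∀ (g : ℝ → ℝ → ℂ → ℂ) (x t : ℝ), 0 < (L - x) / t →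
        (∀ᶠ p : ℝ × ℝ in 𝓝 (x, t), FocusingNLS.IsBoxGFunction q L hq p.1 p.2 (g p.1 p.2)) →
        (∀ z₀ : ℝ,
          FocusingNLS.IsRealDoublePoint
              (fun w => FocusingNLS.phaseH (FocusingNLS.boxF₀ L) g w x t) z₀ ↔
            (L - x) / t = 2 * √2 * q ∧ z₀ = q / √2) ∧
        FocusingNLS.dpCoeff (FocusingNLS.phaseH (FocusingNLS.boxF₀ L) g)
          ((q / √2 : ℝ) : ℂ) x t ≠ 0 ∧
        FocusingNLS.velocity (FocusingNLS.phaseH (FocusingNLS.boxF₀ L) g)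
          ((q / √2 : ℝ) : ℂ) x t = ((2 * √2 * q : ℝ) : ℂ)) := by
  refine ⟨fun h X T Z s₀ hC hA hX hT hZ hregular hD hdp => ?_, fun q L hq =>
    ⟨⟨FocusingNLS.boxG q L, fun x t => FocusingNLS.isBoxGFunction_boxG⟩, fun g x t hv hg => ?_⟩⟩
  · have hcurve := FocusingNLS.deriv_mul_dpCoeff_add_deriv_mul_dqCoeff_eq_zero
      (hC.of_le (by norm_num)) hA hX.hasDerivAt hT.hasDerivAt hZ.hasDerivAt
      (hD.mono fun _ h => h.1) hD.self_of_nhds.2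
    have hT' := FocusingNLS.curve_deriv_snd_ne_zero hdp hregular hcurve
    exact ⟨hT', FocusingNLS.velocity_eq_neg_div hdp hT' hcurve, fun hX' hzzt =>
      FocusingNLS.curve_slope_eq hX' hzzt <|
        FocusingNLS.deriv_mul_hZZZ_add_deriv_mul_hZZX_add_deriv_mul_hZZT_eq_zero hC hA
          hX.hasDerivAt hT.hasDerivAt hZ.hasDerivAt (hD.mono fun _ h => h.2)⟩
  · have hphase := hg.mono fun _ => FocusingNLS.phaseH_eqOn_boxPhase
    exact ⟨FocusingNLS.isRealDoublePoint_iff_of_div_pos hq hv hphase.self_of_nhds,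
      FocusingNLS.dpCoeff_ne_zero_and_velocity_eq hq hphase⟩

theorem mainTheorem8 :
    -- a real double point has the real velocity `-dx/dt`
    (∀ (N M : ℕ) (f₀ : ℂ → ℂ) (hard : Finset ℂ) (C : ℝ → ℝ → FocusingNLS.Contour N M)
      (W : ℝ → ℝ → Fin (N + 1) → ℝ) (Ω : ℝ → ℝ → Fin M → ℝ) (g : ℝ → ℝ → ℂ → ℂ)
      (h : ℂ → ℝ → ℝ → ℂ), h = FocusingNLS.phaseH f₀ g →
      -- the breaking curve `s ↦ (X s, T s)` with the real double points `Z s`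
      ∀ (X T Z : ℝ → ℝ) (s₀ : ℝ),
      (∀ᶠ p : ℝ × ℝ in 𝓝 (X s₀, T s₀),
        FocusingNLS.IsGFunction f₀ hard (C p.1 p.2) (W p.1 p.2) (Ω p.1 p.2) p.1 p.2
          (g p.1 p.2)) →
      -- `h` is smooth in `(z, x, t)` and analytic in `z` near the double point
      ContDiffAt ℝ 3 (fun p : ℂ × ℝ × ℝ => h p.1 p.2.1 p.2.2) ((Z s₀ : ℂ), X s₀, T s₀) →
      (∀ᶠ p : ℂ × ℝ × ℝ in 𝓝 ((Z s₀ : ℂ), X s₀, T s₀),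
        AnalyticAt ℂ (fun w => h w p.2.1 p.2.2) p.1) →
      DifferentiableAt ℝ X s₀ → DifferentiableAt ℝ T s₀ → DifferentiableAt ℝ Z s₀ →
      (deriv X s₀ ≠ 0 ∨ deriv T s₀ ≠ 0) →
      (∀ᶠ s in 𝓝 s₀, FocusingNLS.IsRealDoublePoint (fun w => h w (X s) (T s)) (Z s)) →
      FocusingNLS.dpCoeff h (Z s₀) (X s₀) (T s₀) ≠ 0 →
      deriv T s₀ ≠ 0 ∧
      FocusingNLS.velocity h (Z s₀) (X s₀) (T s₀) = ((-(deriv X s₀ / deriv T s₀) : ℝ) : ℂ) ∧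
      (FocusingNLS.velocity h (Z s₀) (X s₀) (T s₀)).im = 0 ∧
      (deriv X s₀ ≠ 0 → FocusingNLS.hZZT h (Z s₀) (X s₀) (T s₀) ≠ 0 →
        ((deriv T s₀ / deriv X s₀ : ℝ) : ℂ) =
          -(FocusingNLS.hZZZ h (Z s₀) (X s₀) (T s₀) * ((deriv Z s₀ / deriv X s₀ : ℝ) : ℂ)
              + FocusingNLS.hZZX h (Z s₀) (X s₀) (T s₀))
            / FocusingNLS.hZZT h (Z s₀) (X s₀) (T s₀))) ∧
    -- the box potential
    (∀ (q L : ℝ) (hq : 0 < q), 0 < L →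
      (∃ g : ℝ → ℝ → ℂ → ℂ, ∀ x t : ℝ, FocusingNLS.IsBoxGFunction q L hq x t (g x t)) ∧
      ∀ (g : ℝ → ℝ → ℂ → ℂ),
        (∀ x t : ℝ, x < L → 0 < t → FocusingNLS.IsBoxGFunction q L hq x t (g x t)) →
        ∀ (h : ℂ → ℝ → ℝ → ℂ), h = FocusingNLS.phaseH (FocusingNLS.boxF₀ L) g →
        ∀ x t : ℝ, x < L → 0 < t →
          (∀ z₀ : ℝ, FocusingNLS.IsRealDoublePoint (fun w => h w x t) z₀ ↔
            (L - x) / t = 2 * √2 * q ∧ z₀ = q / √2) ∧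
          ((L - x) / t = 2 * √2 * q →
            FocusingNLS.dpCoeff h ((q / √2 : ℝ) : ℂ) x t ≠ 0 ∧
            FocusingNLS.velocity h ((q / √2 : ℝ) : ℂ) x t = ((2 * √2 * q : ℝ) : ℂ))) := by
  refine ⟨?_, fun q L hq _ => ⟨(mainTheorem8_general.2 q L hq).1, ?_⟩⟩
  · rintro N M f₀ hard C W Ω g h - X T Z s₀ - hC hA hX hT hZ hregular hD hdp
    have hZ' := hZ.hasDerivAt.ofReal_comp
    obtain ⟨hT', hvelocity, hslope⟩ := mainTheorem8_general.1 h X T (fun s => (Z s : ℂ)) s₀ hC hA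
      hX hT hZ'.differentiableAt hregular (hD.mono fun _ h => h.2) hdp
    refine ⟨hT', hvelocity, by rw [hvelocity, Complex.ofReal_im], ?_⟩
    simpa only [hZ'.deriv, Complex.ofReal_div] using hslope
  · rintro g hg h rfl x t hx ht
    have hnear : ∀ᶠ p : ℝ × ℝ in 𝓝 (x, t), p.1 < L ∧ 0 < p.2 :=
      prod_mem_nhds (Iio_mem_nhds hx) (Ioi_mem_nhds ht)
    have hbox := (mainTheorem8_general.2 q L hq).2 g x t (div_pos (sub_pos.2 hx) ht)
      (hnear.mono fun p hp => hg p.1 p.2 hp.1 hp.2)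
    exact ⟨hbox.1, fun _ => hbox.2⟩
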